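/- Let $\mathbb S^1=\{z\in\mathbb C:|z|=1\}$ be equipped with arclength measure, let $|x-y|$ denote the Euclidean (chordal) distance in $\mathbb C$, and let $\deg f\in\mathbb Z$ denote the winding number of a continuous map $f:\mathbb S^1\to\mathbb S^1$. For such $f$ and $\delta>0$ put $$I_\delta(f)=\int_{\mathbb S^1}\int_{\mathbb S^1}\frac{\mathbf 1_{\{|f(x)-f(y)|\ge\delta\}}}{|x-y|^2}\,dx\,dy .$$ There exists a universal constant $c$ such that, for every continuous $f:\mathbb S^1\to\mathbb S^1$ and every $0<\delta\le\sqrt3$, $$|\deg f|\le c\,\delta\, I_\delta(f).$$ -/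

import Mathlib

open scoped Real ENNReal NNReal

namespace CircleDegree

/-- The Borel σ-algebra on the unit circle `Circle` of `ℂ`. -/
noncomputable instance instMeasurableSpaceCircle : MeasurableSpace Circle := borel Circle

instance instBorelSpaceCircle : BorelSpace Circle := ⟨rfl⟩

/-- Arclength measure on the unit circle (total mass `2π`): the push-forward of Lebesgue measure
on `(-π, π]` under `t ↦ exp (i t)`. -/
noncomputable def arclength : MeasureTheory.Measure Circle :=
  (MeasureTheory.volume.restrict (Set.Ioc (-π) π)).map Circle.exp

/-- `d` is the winding number of `f`: some continuous angle function `φ` of `f`, that is,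
`f (exp (i t)) = exp (i φ(t))`, increases by `2π d` over one turn. -/
def HasDegree (f : C(Circle, Circle)) (d : ℤ) : Prop :=
  ∃ φ : C(ℝ, ℝ), (∀ t, f (Circle.exp t) = Circle.exp (φ t)) ∧ φ (2 * π) - φ 0 = 2 * π * d

theorem exists_hasDegree (f : C(Circle, Circle)) : ∃ d : ℤ, HasDegree f d := by
  obtain ⟨e, he⟩ : ∃ e : ℝ, Circle.exp e = f 1 := ⟨_, Circle.exp_arg (f 1)⟩
  obtain ⟨φ, ⟨-, hφ⟩, -⟩ := Circle.isCoveringMap_exp.existsUnique_continuousMap_lifts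
    (f.comp Circle.exp) (0 : ℝ) e (by simpa using he)
  have h : ∀ t, f (Circle.exp t) = Circle.exp (φ t) := fun t => (congrFun hφ t).symm
  have h2 : Circle.exp (φ (2 * π)) = Circle.exp (φ 0) := by
    rw [← h, ← h]; simp
  obtain ⟨d, hd⟩ := Circle.exp_eq_exp.1 h2
  exact ⟨d, φ, h, by rw [hd]; ring⟩

/-- The winding number does not depend on the angle function. -/
theorem HasDegree.unique {f : C(Circle, Circle)} {d e : ℤ} (hd : HasDegree f d)
    (he : HasDegree f e) : d = e := by
  obtain ⟨φ, hφ, hd⟩ := hd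
  obtain ⟨ψ, hψ, he⟩ := he
  obtain ⟨m, hm⟩ := Circle.exp_eq_exp.1 ((hφ 0).symm.trans (hψ 0))
  let ψ' : C(ℝ, ℝ) := ⟨fun t => ψ t + m * (2 * π), by fun_prop⟩
  have h' : ∀ t, Circle.exp (ψ' t) = f (Circle.exp t) := fun t => by
    rw [hψ]; exact Circle.exp_eq_exp.2 ⟨m, rfl⟩
  have key : φ = ψ' :=
    (Circle.isCoveringMap_exp.existsUnique_continuousMap_lifts (f.comp Circle.exp) (0 : ℝ) (φ 0)
      (hφ 0).symm).unique ⟨rfl, funext fun t => (hφ t).symm⟩ ⟨hm.symm, funext h'⟩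
  have e1 : φ (2 * π) = ψ (2 * π) + m * (2 * π) := by rw [key]; rfl
  have h2 : 2 * π * (d : ℝ) = 2 * π * e := by rw [← hd, ← he, e1, hm]; ring
  exact_mod_cast mul_left_cancel₀ Real.two_pi_pos.ne' h2

/-- The degree (winding number) of a continuous map from the circle to itself. -/
noncomputable def degree (f : C(Circle, Circle)) : ℤ := (exists_hasDegree f).choose

theorem degree_eq_iff {f : C(Circle, Circle)} {d : ℤ} : degree f = d ↔ HasDegree f d :=
  ⟨fun h => h ▸ (exists_hasDegree f).choose_spec,
    fun h => (exists_hasDegree f).choose_spec.unique h⟩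

/-- `I_δ(f) = ∬ 1_{|f(x) - f(y)| ≥ δ} / |x - y|² dx dy`, an integral of a nonnegative function,
with arclength measure and the Euclidean distance of `ℂ`. For `δ > 0` the indicator vanishes on
the diagonal. -/
noncomputable def thresholdEnergy (δ : ℝ) (f : C(Circle, Circle)) : ℝ≥0∞ :=
  ∫⁻ x : Circle, ∫⁻ y : Circle,
    {q : Circle × Circle | δ ≤ ‖(f q.1 : ℂ) - (f q.2 : ℂ)‖}.indicator
      (fun q => ENNReal.ofReal (1 / ‖(q.1 : ℂ) - (q.2 : ℂ)‖ ^ 2)) (x, y) ∂arclength ∂arclength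

end CircleDegree

namespace CircleDegree

open Finset MeasureTheory

/-! Let `v` be a continuous angle of a map, measured in full turns, so that `v (t + 2 * π) = v t +
d`. Rounding the increments of `v` gives an integer 1-cochain. Its coboundary vanishes on every
triangle without a far edge, because three rounding errors below 1/3 cannot add up to a nonzero
integer. Sum the rounded increments along dyadic meshes of one period. At level 1 the sum is `d` up
to two far edges; at a fine level it is 0, by uniform continuity. Between consecutive levels it
changes by at most the number of far edges in a triangulation of the strip joining them. So the far
edges over all scales number at least `|d|`. Averaging over independent uniform displacements of the
mesh points turns the count at scale `2π / 2 ^ k` into `4 ^ k` times the area of far pairs lying in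
a common double cell, and summing `4 ^ k` over the scales that see `(x, y)` gives the kernel `1 / (x
- y) ^ 2` (`natAbs_le_lintegral_farPairs`). The factor `δ` comes from applying this bound to `N`
maps, `N` of order `1 / δ`: compose `f` with the degree one maps `collapse N j`. Each composition
has the degree of `f`. Being `N`-Lipschitz, they have far pairs only where the images under `f` are
at distance at least `2 sin (π / (3 N)) ≥ δ`. A pair is far for at most two `j`, since one endpoint
must have its image in the `j`-th arc. Summing over `j` gives `N |deg f| ≤ C I_δ(f)`
(`mul_natAbs_degree_le`). -/

/-! ### Rounded increments and their coboundary. -/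

/-- The pairs `(x, y)` such that `v y - v x` is at distance at least `1 / 3` from the integers. -/
def farPairs (v : ℝ → ℝ) : Set (ℝ × ℝ) :=
  {p | 1 / 3 ≤ |v p.2 - v p.1 - round (v p.2 - v p.1)|}

open Classical in
/-- The indicator of `farPairs v`, with natural number values. -/
noncomputable def farInd (v : ℝ → ℝ) (x y : ℝ) : ℕ := if (x, y) ∈ farPairs v then 1 else 0

/-- The integer nearest to the increment of `v` from `x` to `y`. -/
noncomputable def jump (v : ℝ → ℝ) (x y : ℝ) : ℤ := round (v y - v x)

/-- The integer on the left is a signed sum of three rounding errors. Each is at most 1/2, so it is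
at most 1 in absolute value; if no edge is far, each is below 1/3 and it is 0. -/
theorem abs_jump_triangle_le (v : ℝ → ℝ) (x y z : ℝ) :
    |jump v x y + jump v y z - jump v x z| ≤
      (farInd v x y : ℤ) + farInd v y z + farInd v x z := by
  have h1 := abs_le.1 (abs_sub_round (v y - v x))
  have h2 := abs_le.1 (abs_sub_round (v z - v y))
  have h3 := abs_le.1 (abs_sub_round (v z - v x))
  have hle : |jump v x y + jump v y z - jump v x z| ≤ 1 := by
    rw [← Int.lt_add_one_iff, ← @Int.cast_lt ℝ]
    push_cast [jump]
    rw [abs_lt]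
    constructor <;> linarith [h1.1, h1.2, h2.1, h2.2, h3.1, h3.2]
  by_cases a1 : (x, y) ∈ farPairs v
  · have : farInd v x y = 1 := if_pos a1
    omega
  by_cases a2 : (y, z) ∈ farPairs v
  · have : farInd v y z = 1 := if_pos a2
    omega
  by_cases a3 : (x, z) ∈ farPairs v
  · have : farInd v x z = 1 := if_pos a3
    omega
  simp only [farPairs, Set.mem_ofPred_eq, not_le, abs_lt] at a1 a2 a3
  have : |jump v x y + jump v y z - jump v x z| < 1 := by
    rw [← @Int.cast_lt ℝ]
    push_cast [jump]
    rw [abs_lt]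
    constructor <;> linarith [a1.1, a1.2, a2.1, a2.2, a3.1, a3.2]
  omega

/-! ### Jump sums on dyadic meshes. -/

/-- The `j`-th point of the mesh of step `2π / 2 ^ k`, displaced inside its cell by a parameter
that depends only on the parities of `k` and `j`. -/
noncomputable def meshPoint (s : ZMod 2 × ZMod 2 → ℝ) (k j : ℕ) : ℝ :=
  2 * π / 2 ^ k * (j + s (k, j))

/-- For `k ≠ 0` the shift `2 ^ k` is even, so both points use the same displacement. This fails at
level 0, hence the descent starts at level 1. -/
theorem meshPoint_add_two_pow (s : ZMod 2 × ZMod 2 → ℝ) {k : ℕ} (hk : k ≠ 0) (j : ℕ) :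
    meshPoint s k (j + 2 ^ k) = meshPoint s k j + 2 * π := by
  have h2 : ((2 : ZMod 2)) = 0 := rfl
  have : (((j + 2 ^ k : ℕ)) : ZMod 2) = j := by
    push_cast
    rw [h2, zero_pow hk, add_zero]
  unfold meshPoint
  rw [this]
  push_cast
  field_simp
  ring

/-- The number of far pairs among the edges of the three triangles joining the `j`-th cell of
level `k` to the level `k + 1`. -/
noncomputable def farEdges (v : ℝ → ℝ) (s : ZMod 2 × ZMod 2 → ℝ) (k j : ℕ) : ℕ :=
  (farInd v (meshPoint s k j) (meshPoint s k (j + 1))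
    + farInd v (meshPoint s k (j + 1)) (meshPoint s (k + 1) (2 * j + 2))
    + farInd v (meshPoint s k j) (meshPoint s (k + 1) (2 * j + 2)))
  + (farInd v (meshPoint s k j) (meshPoint s (k + 1) (2 * j))
    + farInd v (meshPoint s (k + 1) (2 * j)) (meshPoint s (k + 1) (2 * j + 1))
    + farInd v (meshPoint s k j) (meshPoint s (k + 1) (2 * j + 1)))
  + (farInd v (meshPoint s k j) (meshPoint s (k + 1) (2 * j + 1))
    + farInd v (meshPoint s (k + 1) (2 * j + 1)) (meshPoint s (k + 1) (2 * j + 2))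
    + farInd v (meshPoint s k j) (meshPoint s (k + 1) (2 * j + 2)))

/-- The sum of the jumps of `v` along the mesh of level `k`. -/
noncomputable def jumpSum (v : ℝ → ℝ) (s : ZMod 2 × ZMod 2 → ℝ) (k : ℕ) : ℤ :=
  ∑ j ∈ range (2 ^ k), jump v (meshPoint s k j) (meshPoint s k (j + 1))

theorem sum_range_two_mul {M : Type*} [AddCommMonoid M] (g : ℕ → M) (m : ℕ) :
    ∑ i ∈ range (2 * m), g i = ∑ j ∈ range m, (g (2 * j) + g (2 * j + 1)) := by
  induction m with
  | zero => simp
  | succ m ih => rw [mul_add, mul_one, sum_range_succ, sum_range_succ, sum_range_succ, ih, add_assoc]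

section Lift

variable {v : ℝ → ℝ} {d : ℤ}

theorem jump_add_two_pi (hd : ∀ t, v (t + 2 * π) = v t + d) (x y : ℝ) :
    jump v (x + 2 * π) (y + 2 * π) = jump v x y := by
  simp only [jump, hd, add_sub_add_right_eq_sub]

/-- The strip between the two levels is cut into three triangles per cell. The diagonals cancel, and
the edges joining the levels telescope to 0 by periodicity, leaving the difference of the two jump
sums. -/
theorem abs_jumpSum_le (hd : ∀ t, v (t + 2 * π) = v t + d) (s : ZMod 2 × ZMod 2 → ℝ)
    {k : ℕ} (hk : k ≠ 0) :
    |jumpSum v s k| ≤ |jumpSum v s (k + 1)| + ∑ j ∈ range (2 ^ k), (farEdges v s k j : ℤ) := by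
  have key : jumpSum v s k - jumpSum v s (k + 1) = ∑ j ∈ range (2 ^ k),
      ((jump v (meshPoint s k j) (meshPoint s k (j + 1))
          + jump v (meshPoint s k (j + 1)) (meshPoint s (k + 1) (2 * j + 2))
          - jump v (meshPoint s k j) (meshPoint s (k + 1) (2 * j + 2)))
        - (jump v (meshPoint s k j) (meshPoint s (k + 1) (2 * j))
          + jump v (meshPoint s (k + 1) (2 * j)) (meshPoint s (k + 1) (2 * j + 1))
          - jump v (meshPoint s k j) (meshPoint s (k + 1) (2 * j + 1)))
        - (jump v (meshPoint s k j) (meshPoint s (k + 1) (2 * j + 1))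
          + jump v (meshPoint s (k + 1) (2 * j + 1)) (meshPoint s (k + 1) (2 * j + 2))
          - jump v (meshPoint s k j) (meshPoint s (k + 1) (2 * j + 2)))) := by
    have tel := sum_range_sub
      (fun j => jump v (meshPoint s k j) (meshPoint s (k + 1) (2 * j))) (2 ^ k)
    have per : jump v (meshPoint s k (2 ^ k)) (meshPoint s (k + 1) (2 * 2 ^ k)) =
        jump v (meshPoint s k 0) (meshPoint s (k + 1) (2 * 0)) := by
      have e1 := meshPoint_add_two_pow s hk 0
      have e2 := meshPoint_add_two_pow s (Nat.succ_ne_zero k) 0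
      rw [zero_add] at e1 e2
      rw [← pow_succ', e1, e2, jump_add_two_pi hd]
    rw [per, sub_self] at tel
    simp only [mul_add, mul_one] at tel
    rw [jumpSum, jumpSum, pow_succ' 2 k, sum_range_two_mul, ← sum_sub_distrib, ← sub_eq_zero,
      ← sum_sub_distrib, ← neg_eq_zero, ← sum_neg_distrib, ← tel]
    refine sum_congr rfl fun j _ => ?_
    rw [add_assoc (2 * j) 1 1]
    ring
  have bd : |jumpSum v s k - jumpSum v s (k + 1)| ≤
      ∑ j ∈ range (2 ^ k), (farEdges v s k j : ℤ) := by
    rw [key]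
    refine (abs_sum_le_sum_abs _ _).trans (sum_le_sum fun j _ => ?_)
    refine (abs_sub _ _).trans ((add_le_add_left (abs_sub _ _) _).trans ?_)
    push_cast [farEdges]
    exact add_le_add (add_le_add (abs_jump_triangle_le _ _ _ _) (abs_jump_triangle_le _ _ _ _))
      (abs_jump_triangle_le _ _ _ _)
  have := abs_sub_abs_le_abs_sub (jumpSum v s k) (jumpSum v s (k + 1))
  linarith

/-- The level 1 mesh and its chord over a full period form one triangle; the chord has increment
exactly `d`, so it is never far. -/
theorem abs_le_abs_jumpSum_one (hd : ∀ t, v (t + 2 * π) = v t + d) (s : ZMod 2 × ZMod 2 → ℝ) :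
    |d| ≤ |jumpSum v s 1| + ((farInd v (meshPoint s 1 0) (meshPoint s 1 1) : ℤ)
      + farInd v (meshPoint s 1 1) (meshPoint s 1 2)) := by
  have h := abs_jump_triangle_le v (meshPoint s 1 0) (meshPoint s 1 1) (meshPoint s 1 2)
  have e : meshPoint s 1 2 = meshPoint s 1 0 + 2 * π := by
    simpa using meshPoint_add_two_pow s one_ne_zero 0
  have hr : v (meshPoint s 1 2) - v (meshPoint s 1 0) = d := by rw [e, hd]; ring
  have hj : jump v (meshPoint s 1 0) (meshPoint s 1 2) = d := by
    rw [jump, hr, round_intCast]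
  have hf : farInd v (meshPoint s 1 0) (meshPoint s 1 2) = 0 := by
    refine if_neg ?_
    simp only [farPairs, Set.mem_ofPred_eq, hr, round_intCast, sub_self, abs_zero]
    norm_num
  have hs : jumpSum v s 1 = jump v (meshPoint s 1 0) (meshPoint s 1 1)
      + jump v (meshPoint s 1 1) (meshPoint s 1 2) := by
    simp [jumpSum, sum_range_succ]
  rw [hj, hf, ← hs] at h
  have := abs_sub_abs_le_abs_sub d (jumpSum v s 1)
  rw [abs_sub_comm] at this
  push_cast at h
  linarith

theorem meshPoint_mem_Icc {s : ZMod 2 × ZMod 2 → ℝ} (hs : ∀ c, s c ∈ Set.Icc (0 : ℝ) 1)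
    (k j : ℕ) : meshPoint s k j ∈ Set.Icc (2 * π / 2 ^ k * j) (2 * π / 2 ^ k * (j + 1)) := by
  have h : 0 ≤ 2 * π / 2 ^ k := by positivity
  exact ⟨mul_le_mul_of_nonneg_left (by linarith [(hs (k, j)).1]) h,
    mul_le_mul_of_nonneg_left (by linarith [(hs (k, j)).2]) h⟩

theorem exists_jumpSum_eq_zero (hv : Continuous v) :
    ∃ K, 1 ≤ K ∧ ∀ s : ZMod 2 × ZMod 2 → ℝ, (∀ c, s c ∈ Set.Icc (0 : ℝ) 1) →
      jumpSum v s K = 0 := by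
  -- The endpoint of the last jump may lie beyond `2 * π`, so uniform continuity is taken over two
  -- periods.
  have huc := isCompact_Icc.uniformContinuousOn_of_continuous
    (hv.continuousOn (s := Set.Icc 0 (4 * π)))
  obtain ⟨ε, hε, H⟩ := Metric.uniformContinuousOn_iff.1 huc (1 / 2) (by norm_num)
  obtain ⟨K, hK⟩ := exists_pow_lt_of_lt_one (show 0 < ε / (4 * π) by positivity)
    (show (1 / 2 : ℝ) < 1 by norm_num)
  refine ⟨K + 1, by omega, fun s hs => sum_eq_zero fun j hj => ?_⟩
  have hj' : (j : ℝ) + 1 ≤ 2 ^ (K + 1) := by exact_mod_cast mem_range.1 hj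
  have hlen : 2 * π / 2 ^ (K + 1) < ε / 2 := by
    rw [lt_div_iff₀ (by positivity)] at hK
    rw [one_div, inv_pow] at hK
    have : 2 * π / 2 ^ (K + 1) = ((2 ^ K)⁻¹ * (4 * π)) / 4 := by
      rw [pow_succ]; field_simp
    rw [this]
    linarith
  have hlen0 : 0 < 2 * π / 2 ^ (K + 1) := by positivity
  have htot : 2 * π / 2 ^ (K + 1) * 2 ^ (K + 1) = 2 * π := by field_simp
  have htot1 : 2 * π / 2 ^ (K + 1) ≤ 2 * π := div_le_self (by positivity) (one_le_pow₀ one_le_two)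
  have hle := mul_le_mul_of_nonneg_left hj' hlen0.le
  have hj0 : 0 ≤ 2 * π / 2 ^ (K + 1) * (j : ℝ) := by positivity
  have m1 := meshPoint_mem_Icc hs (K + 1) j
  have m2 := meshPoint_mem_Icc hs (K + 1) (j + 1)
  push_cast at m2
  simp only [Set.mem_Icc, mul_add, mul_one] at m1 m2 hle
  have h := H (meshPoint s (K + 1) (j + 1)) ⟨by linarith [m2.1], by linarith [m2.2]⟩
    (meshPoint s (K + 1) j) ⟨by linarith [m1.1], by linarith [m1.2]⟩ (by
      rw [Real.dist_eq, abs_lt]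
      constructor <;> linarith [m1.1, m1.2, m2.1, m2.2])
  rw [Real.dist_eq, abs_lt] at h
  rw [jump, round_eq_zero_iff]
  exact ⟨by linarith [h.1], by linarith [h.2]⟩

theorem natAbs_le_tsum_farEdges (hv : Continuous v) (hd : ∀ t, v (t + 2 * π) = v t + d)
    {s : ZMod 2 × ZMod 2 → ℝ} (hs : ∀ c, s c ∈ Set.Icc (0 : ℝ) 1) :
    (d.natAbs : ℝ≥0∞) ≤ (farInd v (meshPoint s 1 0) (meshPoint s 1 1) : ℝ≥0∞)
      + farInd v (meshPoint s 1 1) (meshPoint s 1 2)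
      + ∑' k, ∑ j ∈ range (2 ^ (k + 1)), (farEdges v s (k + 1) j : ℝ≥0∞) := by
  obtain ⟨K, hK, hz⟩ := exists_jumpSum_eq_zero hv
  obtain ⟨m, rfl⟩ := Nat.exists_eq_add_of_le' hK
  have ind : ∀ n, |jumpSum v s 1| ≤ |jumpSum v s (n + 1)|
      + ∑ k ∈ range n, ∑ j ∈ range (2 ^ (k + 1)), (farEdges v s (k + 1) j : ℤ) := by
    intro n
    induction n with
    | zero => simp
    | succ n ih =>
      rw [sum_range_succ]
      have := abs_jumpSum_le hd s (Nat.succ_ne_zero n)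
      simp only [Nat.succ_eq_add_one] at this
      linarith
  have h1 := abs_le_abs_jumpSum_one hd s
  have h2 := ind m
  rw [hz s hs, abs_zero, zero_add] at h2
  have h3 : d.natAbs ≤ farInd v (meshPoint s 1 0) (meshPoint s 1 1)
      + farInd v (meshPoint s 1 1) (meshPoint s 1 2)
      + ∑ k ∈ range m, ∑ j ∈ range (2 ^ (k + 1)), farEdges v s (k + 1) j := by
    zify
    linarith
  calc (d.natAbs : ℝ≥0∞) ≤ ((farInd v (meshPoint s 1 0) (meshPoint s 1 1)
      + farInd v (meshPoint s 1 1) (meshPoint s 1 2)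
      + ∑ k ∈ range m, ∑ j ∈ range (2 ^ (k + 1)), farEdges v s (k + 1) j : ℕ) : ℝ≥0∞) := by
        exact_mod_cast h3
    _ ≤ _ := by
      push_cast
      gcongr
      exact ENNReal.sum_le_tsum (f := fun k =>
        ∑ j ∈ range (2 ^ (k + 1)), (farEdges v s (k + 1) j : ℝ≥0∞)) (range m)

end Lift

/-! ### Averaging over the displacements. -/

/-- The uniform law on the parameters displacing the mesh points. -/
noncomputable def meshLaw : Measure (ZMod 2 × ZMod 2 → ℝ) :=
  Measure.pi fun _ => volume.restrict (Set.Icc (0 : ℝ) 1)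

instance instIsProbabilityMeasureIcc :
    IsProbabilityMeasure (volume.restrict (Set.Icc (0 : ℝ) 1)) :=
  ⟨by simp⟩

instance instIsProbabilityMeasureMeshLaw : IsProbabilityMeasure meshLaw := by
  unfold meshLaw; infer_instance

theorem ae_meshLaw_mem_Icc : ∀ᵐ s ∂meshLaw, ∀ c, s c ∈ Set.Icc (0 : ℝ) 1 := by
  rw [ae_all_iff]
  intro c
  exact (Measure.quasiMeasurePreserving_eval _ c).ae
    (ae_restrict_mem (measurableSet_Icc (a := (0 : ℝ)) (b := 1)))

theorem lintegral_meshLaw_pair {c c' : ZMod 2 × ZMod 2} (hc : c ≠ c') {G : ℝ × ℝ → ℝ≥0∞}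
    (hG : Measurable G) :
    ∫⁻ s, G (s c, s c') ∂meshLaw =
      ∫⁻ x in Set.Icc (0 : ℝ) 1, ∫⁻ y in Set.Icc (0 : ℝ) 1, G (x, y) := by
  have hi := (ProbabilityTheory.iIndepFun_pi (X := fun (_ : ZMod 2 × ZMod 2) (x : ℝ) => x)
    (μ := fun _ => volume.restrict (Set.Icc (0 : ℝ) 1)) fun _ => aemeasurable_id).indepFun hc
  have hm := hi.map_prod_eq_prod_map_map (measurable_pi_apply c).aemeasurable
    (measurable_pi_apply c').aemeasurable
  rw [(measurePreserving_eval (fun _ : ZMod 2 × ZMod 2 => volume.restrict (Set.Icc (0 : ℝ) 1)) c).map_eq,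
    (measurePreserving_eval (fun _ : ZMod 2 × ZMod 2 => volume.restrict (Set.Icc (0 : ℝ) 1)) c').map_eq] at hm
  rw [← lintegral_prod _ hG.aemeasurable, ← hm,
    lintegral_map hG ((measurable_pi_apply c).prodMk (measurable_pi_apply c'))]
  rfl

theorem setLIntegral_comp_affine {h : ℝ} (hh : 0 < h) (a : ℝ) (g : ℝ → ℝ≥0∞) :
    ∫⁻ x in Set.Icc (0 : ℝ) 1, g (h * (a + x)) =
      ENNReal.ofReal h⁻¹ * ∫⁻ x in Set.Icc (h * a) (h * (a + 1)), g x := by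
  have him : (fun x => h * (a + x)) '' Set.Icc (0 : ℝ) 1 = Set.Icc (h * a) (h * (a + 1)) := by
    have : (fun x => h * (a + x)) = (fun x => h * x + h * a) := by ext x; ring
    rw [this, Set.image_affine_Icc' hh]
    congr 1 <;> ring
  have hder : ∀ x ∈ Set.Icc (0 : ℝ) 1,
      HasDerivWithinAt (fun x => h * (a + x)) h (Set.Icc 0 1) x := fun x _ => by
    simpa using (((hasDerivAt_id x).const_add a).const_mul h).hasDerivWithinAt
  have hinj : Set.InjOn (fun x => h * (a + x)) (Set.Icc (0 : ℝ) 1) := fun x _ y _ hxy => by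
    simpa [hh.ne'] using hxy
  rw [← him, lintegral_image_eq_lintegral_abs_deriv_mul measurableSet_Icc hder hinj,
    lintegral_const_mul' _ _ ENNReal.ofReal_ne_top, ← mul_assoc, abs_of_pos hh,
    ← ENNReal.ofReal_mul (by positivity), inv_mul_cancel₀ hh.ne', ENNReal.ofReal_one, one_mul]

section

variable {v : ℝ → ℝ}

theorem measurableSet_farPairs (hv : Measurable v) : MeasurableSet (farPairs v) := by
  unfold farPairs
  simp_rw [abs_sub_round_eq_min]
  have h : Measurable fun p : ℝ × ℝ => Int.fract (v p.2 - v p.1) := Measurable.fract (by fun_prop)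
  exact measurableSet_le measurable_const (h.min (measurable_const.sub h))

theorem farInd_eq_indicator (x y : ℝ) :
    (farInd v x y : ℝ≥0∞) = (farPairs v).indicator 1 (x, y) := by
  by_cases h : (x, y) ∈ farPairs v <;> simp [farInd, h]

theorem measurable_farInd (hv : Measurable v) :
    Measurable fun p : ℝ × ℝ => (farInd v p.1 p.2 : ℝ≥0∞) := by
  simp_rw [farInd_eq_indicator]
  exact measurable_one.indicator (measurableSet_farPairs hv)

/-- Two consecutive cells of the mesh of level `k`. -/
def doubleCell (k j : ℕ) : Set ℝ := Set.Icc (2 * π / 2 ^ k * j) (2 * π / 2 ^ k * (j + 2))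

/-- The measure of the far pairs in a double cell. -/
noncomputable def farMass (v : ℝ → ℝ) (k j : ℕ) : ℝ≥0∞ :=
  ∫⁻ p in doubleCell k j ×ˢ doubleCell k j, (farInd v p.1 p.2 : ℝ≥0∞)

theorem measurable_meshPoint (k j : ℕ) :
    Measurable fun s : ZMod 2 × ZMod 2 → ℝ => meshPoint s k j := by
  unfold meshPoint; fun_prop

theorem measurable_farInd_meshPoint (hv : Measurable v) (k j l i : ℕ) :
    Measurable fun s : ZMod 2 × ZMod 2 → ℝ =>
      (farInd v (meshPoint s k j) (meshPoint s l i) : ℝ≥0∞) := by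
  have h : Measurable fun s : ZMod 2 × ZMod 2 → ℝ => (meshPoint s k j, meshPoint s l i) :=
    (measurable_meshPoint k j).prodMk (measurable_meshPoint l i)
  have h' := (measurable_farInd hv).comp h
  simp only [Function.comp_def] at h'
  exact h'

/-- Distinct parities make the two points independent and uniform in their cells. Each density is at
most `2 ^ (m + 1) / (2 * π)`; the 4 pays for `m + 1` in place of `m`. -/
theorem lintegral_farInd_meshPoint_le (hv : Measurable v) {k j l i m q : ℕ}
    (hc : ((k : ZMod 2), (j : ZMod 2)) ≠ ((l : ZMod 2), (i : ZMod 2))) (hk : k ≤ m + 1) (hl : l ≤ m + 1)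
    (hJ : Set.Icc (2 * π / 2 ^ k * j) (2 * π / 2 ^ k * (j + 1)) ⊆ doubleCell m q)
    (hJ' : Set.Icc (2 * π / 2 ^ l * i) (2 * π / 2 ^ l * (i + 1)) ⊆ doubleCell m q) :
    ∫⁻ s, (farInd v (meshPoint s k j) (meshPoint s l i) : ℝ≥0∞) ∂meshLaw ≤
      4 * (ENNReal.ofReal (4 ^ m / (4 * π ^ 2)) * farMass v m q) := by
  have hF := measurable_farInd hv
  have hpos : ∀ n : ℕ, 0 < 2 * π / 2 ^ n := fun n => by positivity
  have hinv : ∀ n ≤ m + 1, (2 * π / 2 ^ n)⁻¹ ≤ 2 ^ (m + 1) / (2 * π) := fun n hn => by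
    rw [inv_div]
    gcongr
    norm_num
  have hG : Measurable fun p : ℝ × ℝ =>
      (farInd v (2 * π / 2 ^ k * (j + p.1)) (2 * π / 2 ^ l * (i + p.2)) : ℝ≥0∞) :=
    hF.comp (f := fun p : ℝ × ℝ => (2 * π / 2 ^ k * (j + p.1), 2 * π / 2 ^ l * (i + p.2)))
      (by fun_prop)
  calc ∫⁻ s, (farInd v (meshPoint s k j) (meshPoint s l i) : ℝ≥0∞) ∂meshLaw
      = ∫⁻ x in Set.Icc (0 : ℝ) 1, ∫⁻ y in Set.Icc (0 : ℝ) 1,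
          (farInd v (2 * π / 2 ^ k * (j + x)) (2 * π / 2 ^ l * (i + y)) : ℝ≥0∞) :=
        lintegral_meshLaw_pair hc hG
    _ = ENNReal.ofReal (2 * π / 2 ^ k)⁻¹ * (ENNReal.ofReal (2 * π / 2 ^ l)⁻¹ *
          ∫⁻ x in Set.Icc (2 * π / 2 ^ k * j) (2 * π / 2 ^ k * (j + 1)),
          ∫⁻ y in Set.Icc (2 * π / 2 ^ l * i) (2 * π / 2 ^ l * (i + 1)),
            (farInd v x y : ℝ≥0∞)) := by
        rw [← lintegral_const_mul' _ _ ENNReal.ofReal_ne_top, ← setLIntegral_comp_affine (hpos k)]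
        refine lintegral_congr fun x => ?_
        exact setLIntegral_comp_affine (hpos l) i
          fun y => (farInd v (2 * π / 2 ^ k * (j + x)) y : ℝ≥0∞)
    _ ≤ ENNReal.ofReal (2 ^ (m + 1) / (2 * π)) * (ENNReal.ofReal (2 ^ (m + 1) / (2 * π)) *
          ∫⁻ x in doubleCell m q, ∫⁻ y in doubleCell m q, (farInd v x y : ℝ≥0∞)) := by
        gcongr
        · exact hinv k hk
        · exact hinv l hl
    _ = _ := by
        have e : (∫⁻ x in doubleCell m q, ∫⁻ y in doubleCell m q, (farInd v x y : ℝ≥0∞)) =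
            farMass v m q := by
          rw [farMass, Measure.volume_eq_prod, ← Measure.prod_restrict,
            lintegral_prod _ hF.aemeasurable]
        have h4 : (4 : ℝ≥0∞) = ENNReal.ofReal 4 := by simp
        rw [e, ← mul_assoc, ← mul_assoc, ← ENNReal.ofReal_mul (by positivity), h4,
          ← ENNReal.ofReal_mul (by positivity)]
        congr 2
        have : (4 : ℝ) ^ m = 2 ^ m * 2 ^ m := by rw [← mul_pow]; norm_num
        rw [this]
        field_simp
        ring

theorem cell_subset_doubleCell {k j q : ℕ} (h : q ≤ j) (h' : j ≤ q + 1) :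
    Set.Icc (2 * π / 2 ^ k * (j : ℝ)) (2 * π / 2 ^ k * (j + 1)) ⊆ doubleCell k q := by
  have h1 : (q : ℝ) ≤ j := by exact_mod_cast h
  have h2 : (j : ℝ) ≤ q + 1 := by exact_mod_cast h'
  refine Set.Icc_subset_Icc ?_ ?_ <;> refine mul_le_mul_of_nonneg_left ?_ (by positivity) <;>
    linarith

theorem cell_succ_subset_doubleCell {k j q : ℕ} (h : 2 * q ≤ j) (h' : j ≤ 2 * q + 3) :
    Set.Icc (2 * π / 2 ^ (k + 1) * (j : ℝ)) (2 * π / 2 ^ (k + 1) * (j + 1)) ⊆ doubleCell k q := by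
  have h1 : 2 * (q : ℝ) ≤ j := by exact_mod_cast h
  have h2 : (j : ℝ) ≤ 2 * q + 3 := by exact_mod_cast h'
  have e : 2 * π / 2 ^ k = 2 * π / 2 ^ (k + 1) * 2 := by rw [pow_succ]; field_simp
  rw [doubleCell, e]
  refine Set.Icc_subset_Icc ?_ ?_ <;> rw [mul_assoc _ (2 : ℝ)] <;>
    refine mul_le_mul_of_nonneg_left ?_ (by positivity) <;> linarith

/-- Nine edges at cost 4 each. The endpoints of an edge differ in the parity of the level or, within
a level, of the index, so four parameters suffice. -/
theorem lintegral_farEdges_le (hv : Measurable v) (k j : ℕ) :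
    ∫⁻ s, (farEdges v s k j : ℝ≥0∞) ∂meshLaw ≤
      36 * (ENNReal.ofReal (4 ^ k / (4 * π ^ 2)) * farMass v k j) := by
  have hm := measurable_farInd_meshPoint hv
  have z1 : ∀ a : ZMod 2, a ≠ a + 1 := by decide
  have c1 : ∀ n : ℕ, ((k : ZMod 2), (n : ZMod 2)) ≠ ((k : ZMod 2), ((n + 1 : ℕ) : ZMod 2)) :=
    fun n h => z1 n (by simpa using congrArg Prod.snd h)
  have c1' : ∀ n : ℕ, (((k + 1 : ℕ) : ZMod 2), (n : ZMod 2)) ≠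
      (((k + 1 : ℕ) : ZMod 2), ((n + 1 : ℕ) : ZMod 2)) :=
    fun n h => z1 n (by simpa using congrArg Prod.snd h)
  have c2 : ∀ a b : ℕ, ((k : ZMod 2), (a : ZMod 2)) ≠ (((k + 1 : ℕ) : ZMod 2), (b : ZMod 2)) :=
    fun a b h => z1 k (by simpa using congrArg Prod.fst h)
  unfold farEdges
  push_cast
  rw [lintegral_add_left (by fun_prop), lintegral_add_left (by fun_prop),
    lintegral_add_left (by fun_prop), lintegral_add_left (by fun_prop),
    lintegral_add_left (by fun_prop), lintegral_add_left (by fun_prop),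
    lintegral_add_left (by fun_prop), lintegral_add_left (by fun_prop)]
  have s0 := cell_subset_doubleCell (k := k) (le_refl j) (Nat.le_succ j)
  have s1 := cell_subset_doubleCell (k := k) (Nat.le_succ j) (le_refl (j + 1))
  have t0 := cell_succ_subset_doubleCell (k := k) (j := 2 * j) (q := j) (by omega) (by omega)
  have t1 := cell_succ_subset_doubleCell (k := k) (j := 2 * j + 1) (q := j) (by omega) (by omega)
  have t2 := cell_succ_subset_doubleCell (k := k) (j := 2 * j + 2) (q := j) (by omega) (by omega)
  have l0 : k ≤ k + 1 := Nat.le_succ k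
  have l1 : k + 1 ≤ k + 1 := le_rfl
  refine (add_le_add (add_le_add
    (add_le_add (add_le_add (lintegral_farInd_meshPoint_le hv (c1 j) l0 l0 s0 s1)
      (lintegral_farInd_meshPoint_le hv (c2 _ _) l0 l1 s1 t2))
      (lintegral_farInd_meshPoint_le hv (c2 _ _) l0 l1 s0 t2))
    (add_le_add (add_le_add (lintegral_farInd_meshPoint_le hv (c2 _ _) l0 l1 s0 t0)
      (lintegral_farInd_meshPoint_le hv (c1' _) l1 l1 t0 t1))
      (lintegral_farInd_meshPoint_le hv (c2 _ _) l0 l1 s0 t1)))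
    (add_le_add (add_le_add (lintegral_farInd_meshPoint_le hv (c2 _ _) l0 l1 s0 t1)
      (lintegral_farInd_meshPoint_le hv (c1' _) l1 l1 t1 t2))
      (lintegral_farInd_meshPoint_le hv (c2 _ _) l0 l1 s0 t2))).trans (le_of_eq ?_)
  ring

theorem natAbs_le_tsum_farMass {d : ℤ} (hv : Continuous v)
    (hd : ∀ t, v (t + 2 * π) = v t + d) :
    (d.natAbs : ℝ≥0∞) ≤
      36 * ∑' k, ∑ j ∈ range (2 ^ k), ENNReal.ofReal (4 ^ k / (4 * π ^ 2)) * farMass v k j := by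
  have hm := measurable_farInd_meshPoint hv.measurable
  have hmE : ∀ k j, Measurable fun s => (farEdges v s k j : ℝ≥0∞) := fun k j => by
    unfold farEdges; push_cast; fun_prop
  have c0 : (((1 : ℕ) : ZMod 2), ((0 : ℕ) : ZMod 2)) ≠ (((1 : ℕ) : ZMod 2), ((1 : ℕ) : ZMod 2)) := by
    decide
  have c1 : (((1 : ℕ) : ZMod 2), ((1 : ℕ) : ZMod 2)) ≠ (((1 : ℕ) : ZMod 2), ((2 : ℕ) : ZMod 2)) := by
    decide
  have t0 := cell_succ_subset_doubleCell (k := 0) (j := 0) (q := 0) (by omega) (by omega)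
  have t1 := cell_succ_subset_doubleCell (k := 0) (j := 1) (q := 0) (by omega) (by omega)
  have t2 := cell_succ_subset_doubleCell (k := 0) (j := 2) (q := 0) (by omega) (by omega)
  calc (d.natAbs : ℝ≥0∞) = ∫⁻ _, (d.natAbs : ℝ≥0∞) ∂meshLaw := by simp
    _ ≤ ∫⁻ s, ((farInd v (meshPoint s 1 0) (meshPoint s 1 1) : ℝ≥0∞)
          + farInd v (meshPoint s 1 1) (meshPoint s 1 2)
          + ∑' k, ∑ j ∈ range (2 ^ (k + 1)), (farEdges v s (k + 1) j : ℝ≥0∞)) ∂meshLaw := by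
        refine lintegral_mono_ae ?_
        filter_upwards [ae_meshLaw_mem_Icc] with s hs
        exact natAbs_le_tsum_farEdges hv hd hs
    _ = ∫⁻ s, (farInd v (meshPoint s 1 0) (meshPoint s 1 1) : ℝ≥0∞) ∂meshLaw
          + ∫⁻ s, (farInd v (meshPoint s 1 1) (meshPoint s 1 2) : ℝ≥0∞) ∂meshLaw
          + ∑' k, ∑ j ∈ range (2 ^ (k + 1)),
            ∫⁻ s, (farEdges v s (k + 1) j : ℝ≥0∞) ∂meshLaw := by
        rw [lintegral_add_left (by fun_prop), lintegral_add_left (by fun_prop), lintegral_tsum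
          fun k => (Finset.measurable_sum _ fun j _ => hmE (k + 1) j).aemeasurable]
        congr 2
        ext k
        rw [lintegral_finsetSum _ fun j _ => hmE (k + 1) j]
    _ ≤ 36 * (∑ j ∈ range (2 ^ 0), ENNReal.ofReal (4 ^ 0 / (4 * π ^ 2)) * farMass v 0 j)
          + 36 * ∑' k, ∑ j ∈ range (2 ^ (k + 1)),
            ENNReal.ofReal (4 ^ (k + 1) / (4 * π ^ 2)) * farMass v (k + 1) j := by
        rw [← ENNReal.tsum_mul_left]
        refine add_le_add ?_ (ENNReal.tsum_le_tsum fun k => ?_)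
        · refine (add_le_add
            (lintegral_farInd_meshPoint_le hv.measurable c0 le_rfl le_rfl t0 t1)
            (lintegral_farInd_meshPoint_le hv.measurable c1 le_rfl le_rfl t1 t2)).trans ?_
          -- The two initial edges cost 4 + 4, which the factor 36 absorbs.
          rw [← add_mul, pow_zero 2, sum_range_one]
          gcongr
          norm_num
        · rw [mul_sum]
          exact sum_le_sum fun j _ => lintegral_farEdges_le hv.measurable (k + 1) j
    _ = _ := by
        rw [← mul_add, tsum_eq_zero_add' (f := fun k => ∑ j ∈ range (2 ^ k),
          ENNReal.ofReal (4 ^ k / (4 * π ^ 2)) * farMass v k j) ENNReal.summable]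

/-! ### Summation over the scales. -/

/-- Double cells overlap: their indices `j` satisfy `x / h - 2 ≤ j ≤ x / h`, which leaves at most
three. -/
theorem sum_range_doubleCell_le (k n : ℕ) (x y : ℝ) :
    ∑ j ∈ range n, (doubleCell k j ×ˢ doubleCell k j).indicator (1 : ℝ × ℝ → ℝ≥0∞) (x, y) ≤
      if |x - y| ≤ 2 * (2 * π / 2 ^ k) then 3 else 0 := by
  classical
  have hh : 0 < 2 * π / 2 ^ k := by positivity
  set h := 2 * π / 2 ^ k with hdef
  split_ifs with hxy
  · set N := ⌊x / h⌋₊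
    calc ∑ j ∈ range n, (doubleCell k j ×ˢ doubleCell k j).indicator (1 : ℝ × ℝ → ℝ≥0∞) (x, y)
        ≤ ∑ j ∈ range n, if j ∈ Finset.Icc (N - 2) N then (1 : ℝ≥0∞) else 0 := by
          refine sum_le_sum fun j _ => ?_
          by_cases hp : (x, y) ∈ doubleCell k j ×ˢ doubleCell k j
          · obtain ⟨⟨h1, h2⟩, -⟩ := hp
            simp only at h1 h2
            rw [← hdef] at h1 h2
            have m : j ∈ Finset.Icc (N - 2) N := by
              rw [Finset.mem_Icc]
              constructor
              · have : x / h ≤ ((j + 2 : ℕ) : ℝ) := by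
                  rw [div_le_iff₀ hh]; push_cast; linarith
                have := Nat.floor_le_of_le this
                omega
              · exact Nat.le_floor (by rw [le_div_iff₀ hh]; linarith)
            rw [if_pos m]
            exact Set.indicator_le_self' (fun _ _ => zero_le) _
          · rw [Set.indicator_of_notMem hp]; exact zero_le
      _ ≤ ((Finset.Icc (N - 2) N).card : ℝ≥0∞) := by
          rw [sum_ite_mem, sum_const, nsmul_one]
          exact_mod_cast card_le_card inter_subset_right
      _ ≤ 3 := by
          rw [Nat.card_Icc]
          exact_mod_cast (by omega : N + 1 - (N - 2) ≤ 3)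
  · refine (sum_eq_zero fun j _ => Set.indicator_of_notMem ?_ _).le
    rintro ⟨⟨h1, h2⟩, h3, h4⟩
    simp only at h1 h2 h3 h4
    rw [← hdef] at h1 h2 h3 h4
    refine hxy (abs_le.2 ⟨?_, ?_⟩) <;> nlinarith

theorem sum_range_four_pow_le {M : ℝ} (hM : 0 ≤ M) (n : ℕ) :
    ∑ k ∈ range n, (if (4 : ℝ) ^ k ≤ M then (4 : ℝ) ^ k else 0) ≤ 4 / 3 * M := by
  induction n with
  | zero => simpa using hM
  | succ n ih =>
    by_cases h : (4 : ℝ) ^ n ≤ M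
    · have h1 : ∑ k ∈ range (n + 1), (if (4 : ℝ) ^ k ≤ M then (4 : ℝ) ^ k else 0) ≤
          ∑ k ∈ range (n + 1), (4 : ℝ) ^ k := by
        refine sum_le_sum fun k _ => ?_
        split_ifs
        · exact le_rfl
        · positivity
      rw [geom_sum_eq (by norm_num), pow_succ] at h1
      linarith
    · rw [sum_range_succ, if_neg h, add_zero]
      exact ih

theorem tsum_doubleCell_le {x y : ℝ} (hxy : x ≠ y) :
    ∑' k, ∑ j ∈ range (2 ^ k), ENNReal.ofReal (4 ^ k / (4 * π ^ 2)) *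
      (doubleCell k j ×ˢ doubleCell k j).indicator (1 : ℝ × ℝ → ℝ≥0∞) (x, y) ≤
      16 * ENNReal.ofReal (1 / (x - y) ^ 2) := by
  have hρ : 0 < |x - y| := abs_pos.2 (sub_ne_zero.2 hxy)
  have hsq : |x - y| ^ 2 = (x - y) ^ 2 := sq_abs _
  -- A common double cell forces `|x - y| ≤ 4π / 2 ^ k`, that is, `4 ^ k ≤ M`.
  set M : ℝ := 16 * π ^ 2 / (x - y) ^ 2 with hM
  have hM0 : 0 ≤ M := by positivity
  have term : ∀ k, ∑ j ∈ range (2 ^ k), ENNReal.ofReal (4 ^ k / (4 * π ^ 2)) *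
      (doubleCell k j ×ˢ doubleCell k j).indicator (1 : ℝ × ℝ → ℝ≥0∞) (x, y) ≤
      ENNReal.ofReal (3 / (4 * π ^ 2) * if (4 : ℝ) ^ k ≤ M then (4 : ℝ) ^ k else 0) := by
    intro k
    rw [← mul_sum]
    refine (mul_le_mul_right (sum_range_doubleCell_le k (2 ^ k) x y) _).trans ?_
    by_cases h : |x - y| ≤ 2 * (2 * π / 2 ^ k)
    · have h4 : (4 : ℝ) ^ k ≤ M := by
        have e : (4 : ℝ) ^ k = (2 ^ k) ^ 2 := by rw [← pow_mul, mul_comm, pow_mul]; norm_num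
        have h' : |x - y| * 2 ^ k ≤ 4 * π := by
          rw [← le_div_iff₀ (by positivity)]
          exact h.trans (le_of_eq (by ring))
        rw [hM, le_div_iff₀ (by rw [← hsq]; positivity), e, ← hsq, ← mul_pow, mul_comm]
        calc (|x - y| * 2 ^ k) ^ 2 ≤ (4 * π) ^ 2 := by gcongr
          _ = _ := by ring
      have h3 : (3 : ℝ≥0∞) = ENNReal.ofReal 3 := by simp
      rw [if_pos h, if_pos h4, h3, ← ENNReal.ofReal_mul (by positivity)]
      exact ENNReal.ofReal_le_ofReal (le_of_eq (by ring))
    · rw [if_neg h, mul_zero]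
      exact zero_le
  refine ENNReal.tsum_le_of_sum_range_le fun n => (sum_le_sum fun k _ => term k).trans ?_
  have h16 : (16 : ℝ≥0∞) = ENNReal.ofReal 16 := by simp
  rw [← ENNReal.ofReal_sum_of_nonneg fun k _ => by positivity, ← mul_sum, h16,
    ← ENNReal.ofReal_mul (by positivity)]
  refine ENNReal.ofReal_le_ofReal ?_
  calc 3 / (4 * π ^ 2) * ∑ k ∈ range n, (if (4 : ℝ) ^ k ≤ M then (4 : ℝ) ^ k else 0)
      ≤ 3 / (4 * π ^ 2) * (4 / 3 * M) := by
        gcongr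
        exact sum_range_four_pow_le hM0 n
    _ = _ := by
        rw [hM]
        have : x - y ≠ 0 := sub_ne_zero.2 hxy
        field_simp

theorem doubleCell_subset {k j : ℕ} (hj : j ∈ range (2 ^ k)) :
    doubleCell k j ⊆ Set.Icc 0 (4 * π) := by
  have h1 : (j : ℝ) + 1 ≤ 2 ^ k := by exact_mod_cast mem_range.1 hj
  have h2 : (1 : ℝ) ≤ 2 ^ k := one_le_pow₀ one_le_two
  refine Set.Icc_subset_Icc (by positivity) ?_
  calc 2 * π / 2 ^ k * ((j : ℝ) + 2) ≤ 2 * π / 2 ^ k * (2 * 2 ^ k) := by gcongr; linarith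
    _ = 4 * π := by field_simp; norm_num

/-- The far pairs of a lift of a degree `d` map carry energy at least a multiple of `|d|`. -/
theorem natAbs_le_lintegral_farPairs {d : ℤ} (hv : Continuous v)
    (hd : ∀ t, v (t + 2 * π) = v t + d) :
    (d.natAbs : ℝ≥0∞) ≤ 576 * ∫⁻ p in Set.Icc 0 (4 * π) ×ˢ Set.Icc 0 (4 * π),
      (farPairs v).indicator (fun p => ENNReal.ofReal (1 / (p.1 - p.2) ^ 2)) p := by
  have hF := measurable_farInd hv.measurable
  have hcell : ∀ k j, MeasurableSet (doubleCell k j ×ˢ doubleCell k j) := fun k j =>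
    measurableSet_Icc.prod measurableSet_Icc
  refine (natAbs_le_tsum_farMass hv hd).trans ?_
  rw [show (576 : ℝ≥0∞) = 36 * 16 by norm_num, mul_assoc]
  refine mul_le_mul_right ?_ 36
  have e : ∀ k, ∀ j ∈ range (2 ^ k), ENNReal.ofReal (4 ^ k / (4 * π ^ 2)) * farMass v k j =
      ∫⁻ p in Set.Icc 0 (4 * π) ×ˢ Set.Icc 0 (4 * π), ENNReal.ofReal (4 ^ k / (4 * π ^ 2)) *
        (doubleCell k j ×ˢ doubleCell k j).indicator
          (fun p : ℝ × ℝ => (farInd v p.1 p.2 : ℝ≥0∞)) p := by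
    intro k j hj
    rw [lintegral_const_mul' _ _ ENNReal.ofReal_ne_top, lintegral_indicator (hcell k j),
      Measure.restrict_restrict (hcell k j), Set.inter_eq_left.2
        (Set.prod_mono (doubleCell_subset hj) (doubleCell_subset hj)), farMass]
  rw [tsum_congr fun k => sum_congr rfl (e k)]
  have hmeas : ∀ k j, Measurable fun p : ℝ × ℝ => ENNReal.ofReal (4 ^ k / (4 * π ^ 2)) *
        (doubleCell k j ×ˢ doubleCell k j).indicator
          (fun p : ℝ × ℝ => (farInd v p.1 p.2 : ℝ≥0∞)) p := fun k j =>
    (hF.indicator (hcell k j)).const_mul _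
  simp_rw [← lintegral_finsetSum _ fun j _ => hmeas _ j]
  rw [← lintegral_tsum fun k => (Finset.measurable_sum _ fun j _ => hmeas k j).aemeasurable,
    ← lintegral_const_mul' _ _ (by norm_num)]
  refine lintegral_mono fun p => ?_
  obtain ⟨x, y⟩ := p
  by_cases hp : (x, y) ∈ farPairs v
  · have hxy : x ≠ y := by
      rintro rfl
      simp only [farPairs, Set.mem_ofPred_eq, sub_self, round_zero, Int.cast_zero, abs_zero] at hp
      norm_num at hp
    have h1 : farInd v x y = 1 := if_pos hp
    rw [Set.indicator_of_mem hp]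
    refine le_trans (le_of_eq ?_) (tsum_doubleCell_le hxy)
    refine tsum_congr fun k => sum_congr rfl fun j _ => ?_
    congr 1
    by_cases hq : (x, y) ∈ doubleCell k j ×ˢ doubleCell k j
    · rw [Set.indicator_of_mem hq, Set.indicator_of_mem hq]; simp [h1]
    · rw [Set.indicator_of_notMem hq, Set.indicator_of_notMem hq]
  · have h0 : farInd v x y = 0 := if_neg hp
    refine le_trans (le_of_eq ?_) (zero_le)
    refine ENNReal.tsum_eq_zero.2 fun k => sum_eq_zero fun j _ => ?_
    by_cases hq : (x, y) ∈ doubleCell k j ×ˢ doubleCell k j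
    · rw [Set.indicator_of_mem hq]; simp [h0]
    · rw [Set.indicator_of_notMem hq, mul_zero]

end

/-! ### Collapsing maps of the circle. -/

/-- A lift of the degree one map of `ℝ / ℤ` that expands the `j`-th of `N` equal arcs to the whole
circle and collapses the other ones. -/
noncomputable def collapse (N j : ℕ) (t : ℝ) : ℝ :=
  ⌊t⌋ + max 0 (min 1 (N * Int.fract t - j))

theorem collapse_add_intCast (N j : ℕ) (t : ℝ) (m : ℤ) :
    collapse N j (t + m) = collapse N j t + m := by
  simp only [collapse, Int.floor_add_intCast, Int.fract_add_intCast]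
  push_cast
  ring

/-- Within a unit interval the profile is a clamped line of slope `N`. Across integers, compare it
with the lines of slope `N` through its end values 0 and 1; the whole turns in between cost no more
because `N ≥ 1`. -/
theorem abs_collapse_sub_le {N j : ℕ} (hj : j < N) (s t : ℝ) :
    |collapse N j t - collapse N j s| ≤ N * |t - s| := by
  wlog hst : s ≤ t generalizing s t
  · rw [abs_sub_comm, abs_sub_comm t s]
    exact this t s (le_of_not_ge hst)
  have hj' : (j : ℝ) + 1 ≤ N := by exact_mod_cast hj
  have hj0 : (0 : ℝ) ≤ j := j.cast_nonneg
  have hs0 := Int.fract_nonneg s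
  have hs1 := (Int.fract_lt_one s).le
  have ht0 := Int.fract_nonneg t
  have ht1 := (Int.fract_lt_one t).le
  have hs := Int.floor_add_fract s
  have ht := Int.floor_add_fract t
  have hN : (0 : ℝ) ≤ N := by linarith
  rw [abs_of_nonneg (sub_nonneg.2 hst)]
  unfold collapse
  rcases (Int.floor_le_floor hst).eq_or_lt with h | h
  · have e : t - s = Int.fract t - Int.fract s := by
      rw [h] at hs
      linarith
    have h0 : 0 ≤ (N : ℝ) * (Int.fract t - Int.fract s) :=
      mul_nonneg hN (by rw [← e]; linarith)
    rw [e, h]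
    rw [mul_sub] at h0 ⊢
    rw [abs_le]
    constructor <;> grind
  · have h' : (⌊s⌋ : ℝ) + 1 ≤ ⌊t⌋ := by exact_mod_cast h
    have u1 : max 0 (min 1 ((N : ℝ) * Int.fract t - j)) ≤ N * Int.fract t :=
      max_le (by positivity) ((min_le_right _ _).trans (by linarith))
    have u0 : 0 ≤ max 0 (min 1 ((N : ℝ) * Int.fract t - j)) := le_max_left _ _
    have l1 : max 0 (min 1 ((N : ℝ) * Int.fract s - j)) ≤ 1 :=
      max_le zero_le_one (min_le_left _ _)
    have l0 : 1 - N * (1 - Int.fract s) ≤ max 0 (min 1 ((N : ℝ) * Int.fract s - j)) := by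
      refine le_max_of_le_right (le_min ?_ ?_)
      · have := mul_nonneg hN (sub_nonneg.2 hs1)
        linarith
      · linarith
    have e : (N : ℝ) * (t - s) =
        N * ((⌊t⌋ : ℝ) - ⌊s⌋ - 1) + N * Int.fract t + N * (1 - Int.fract s) := by
      rw [← mul_add, ← mul_add]
      congr 1
      linarith
    have hN1 : (1 : ℝ) ≤ N := by linarith
    have := mul_le_mul_of_nonneg_right hN1 (show 0 ≤ (⌊t⌋ : ℝ) - ⌊s⌋ - 1 by linarith)
    rw [e, abs_le]
    constructor <;> nlinarith

theorem continuous_collapse {N j : ℕ} (hj : j < N) : Continuous (collapse N j) :=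
  (LipschitzWith.of_dist_le_mul (K := N) fun t s => by
    simpa [Real.dist_eq] using abs_collapse_sub_le hj s t).continuous

theorem exists_collapse_eq_intCast {N j : ℕ} {t : ℝ} (h : ⌊N * Int.fract t⌋₊ ≠ j) :
    ∃ m : ℤ, collapse N j t = m := by
  have h0 : 0 ≤ N * Int.fract t := mul_nonneg N.cast_nonneg (Int.fract_nonneg t)
  rcases lt_or_gt_of_ne h with h | h
  · refine ⟨⌊t⌋, ?_⟩
    have : N * Int.fract t < j := (Nat.floor_lt h0).1 h
    rw [collapse, max_eq_left ((min_le_right _ _).trans (by linarith)), add_zero]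
  · refine ⟨⌊t⌋ + 1, ?_⟩
    have : ((j + 1 : ℕ) : ℝ) ≤ N * Int.fract t := (Nat.le_floor_iff h0).1 h
    push_cast at this
    rw [collapse, min_eq_left (by linarith), max_eq_right zero_le_one]
    push_cast
    rfl

theorem norm_exp_sub_exp (a b : ℝ) :
    ‖(Circle.exp a : ℂ) - (Circle.exp b : ℂ)‖ = 2 * |Real.sin ((a - b) / 2)| := by
  have e : (Circle.exp a : ℂ) - (Circle.exp b : ℂ) =
      (Circle.exp b : ℂ) * (Complex.exp (Complex.I * ((a - b : ℝ) : ℂ)) - 1) := by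
    rw [mul_sub, mul_one, Circle.coe_exp, Circle.coe_exp, ← Complex.exp_add]
    congr 2
    push_cast
    ring
  rw [e, norm_mul, Circle.norm_coe, one_mul, Complex.norm_exp_I_mul_ofReal_sub_one,
    Real.norm_eq_abs, abs_mul, abs_two]

theorem norm_exp_sub_exp_le (a b : ℝ) :
    ‖(Circle.exp a : ℂ) - (Circle.exp b : ℂ)‖ ≤ |a - b| := by
  rw [norm_exp_sub_exp]
  have := Real.abs_sin_le_abs (x := (a - b) / 2)
  rw [abs_div, abs_two] at this
  linarith

/-- If two points of the circle are close, then their angles are close up to full turns. -/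
theorem exists_int_abs_sub_lt {N : ℕ} (hN : 1 ≤ N) {a b : ℝ}
    (h : ‖(Circle.exp a : ℂ) - (Circle.exp b : ℂ)‖ < 2 * Real.sin (π / (3 * N))) :
    ∃ m : ℤ, |b / (2 * π) - a / (2 * π) - m| < 1 / (3 * N) := by
  refine ⟨round (b / (2 * π) - a / (2 * π)), ?_⟩
  have hN' : (1 : ℝ) ≤ N := by exact_mod_cast hN
  have hpi := Real.pi_pos
  set m := round (b / (2 * π) - a / (2 * π)) with hm
  set r := b / (2 * π) - a / (2 * π) - m with hr
  have hr2 : |r| ≤ 1 / 2 := abs_sub_round _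
  by_contra! hge
  have hb : b - a = 2 * π * r + m * (2 * π) := by
    rw [hr]; field_simp; ring
  have e : ‖(Circle.exp a : ℂ) - (Circle.exp b : ℂ)‖ = 2 * Real.sin (π * |r|) := by
    have : Circle.exp b = Circle.exp (a + 2 * π * r) :=
      Circle.exp_eq_exp.2 ⟨m, by linarith⟩
    rw [this, norm_sub_rev, norm_exp_sub_exp]
    have : (a + 2 * π * r - a) / 2 = π * r := by ring
    rw [this]
    congr 1
    rcases le_total 0 r with h0 | h0
    · rw [abs_of_nonneg h0, abs_of_nonneg]
      rw [abs_of_nonneg h0] at hr2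
      exact Real.sin_nonneg_of_nonneg_of_le_pi (by positivity) (by nlinarith)
    · rw [abs_of_nonpos h0] at hr2 ⊢
      rw [mul_neg, Real.sin_neg, abs_of_nonpos]
      exact Real.sin_nonpos_of_nonpos_of_neg_pi_le (by nlinarith) (by nlinarith)
  rw [e] at h
  have hle : Real.sin (π / (3 * N)) ≤ Real.sin (π * |r|) := by
    have h1 : π / (3 * N) ≤ π * |r| := by
      rw [div_eq_mul_one_div]
      exact mul_le_mul_of_nonneg_left hge hpi.le
    refine Real.sin_le_sin_of_le_of_le_pi_div_two ?_ (by nlinarith) h1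
    have : 0 ≤ π / (3 * N) := by positivity
    linarith
  linarith

theorem farPairs_collapse_subset {N j : ℕ} (hj : j < N) (φ : ℝ → ℝ) {x y : ℝ}
    (h : (x, y) ∈ farPairs fun t => collapse N j (φ t / (2 * π))) :
    2 * Real.sin (π / (3 * N)) ≤ ‖(Circle.exp (φ x) : ℂ) - (Circle.exp (φ y) : ℂ)‖ ∧
      (⌊N * Int.fract (φ x / (2 * π))⌋₊ = j ∨ ⌊N * Int.fract (φ y / (2 * π))⌋₊ = j) := by
  simp only [farPairs, Set.mem_ofPred_eq] at h
  have hN : (1 : ℝ) ≤ N := by exact_mod_cast (by omega : 1 ≤ N)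
  constructor
  · by_contra! hlt
    obtain ⟨m, hm⟩ := exists_int_abs_sub_lt (by omega) hlt
    -- The nearest integer can only be closer than `m`, so the distance to `m` is at least 1/3 too.
    have h1 := h.trans (round_le _ m)
    have h2 := abs_collapse_sub_le hj (φ x / (2 * π) + m) (φ y / (2 * π))
    rw [collapse_add_intCast, ← sub_sub, ← sub_sub] at h2
    have h3 : N * |φ y / (2 * π) - φ x / (2 * π) - m| < N * (1 / (3 * N)) :=
      mul_lt_mul_of_pos_left hm (by linarith)
    have h4 : (N : ℝ) * (1 / (3 * N)) = 1 / 3 := by field_simp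
    linarith
  · by_contra! hne
    obtain ⟨m, hm⟩ := exists_collapse_eq_intCast hne.1
    obtain ⟨n, hn⟩ := exists_collapse_eq_intCast hne.2
    rw [hm, hn, ← Int.cast_sub, round_intCast, sub_self, abs_zero] at h
    norm_num at h

/-! ### Transfer to the circle and sum over the arcs. -/

/-- The pairs of points of the circle with `f`-images at distance at least `δ`, weighted. -/
noncomputable def energyDensity (δ : ℝ) (f : C(Circle, Circle)) (q : Circle × Circle) : ℝ≥0∞ :=
  {q : Circle × Circle | δ ≤ ‖(f q.1 : ℂ) - (f q.2 : ℂ)‖}.indicator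
    (fun q => ENNReal.ofReal (1 / ‖(q.1 : ℂ) - (q.2 : ℂ)‖ ^ 2)) q

theorem measurable_energyDensity (δ : ℝ) (f : C(Circle, Circle)) :
    Measurable (energyDensity δ f) := by
  have h1 : Continuous fun q : Circle × Circle => ‖(f q.1 : ℂ) - (f q.2 : ℂ)‖ := by fun_prop
  have h2 : Continuous fun q : Circle × Circle => ‖(q.1 : ℂ) - (q.2 : ℂ)‖ := by fun_prop
  exact Measurable.indicator ((h2.measurable.pow_const 2).const_div 1).ennreal_ofReal
    (measurableSet_le measurable_const h1.measurable)

/-- The interval consists of two periods, and every period is a fundamental domain for the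
translations by `2 * π`. -/
theorem setLIntegral_comp_exp {g : Circle → ℝ≥0∞} (hg : Measurable g) :
    ∫⁻ x in Set.Icc 0 (4 * π), g (Circle.exp x) = 2 * ∫⁻ z, g z ∂arclength := by
  have hT : 0 < 2 * π := Real.two_pi_pos
  have hper : Function.Periodic (fun x => g (Circle.exp x)) (2 * π) := fun x => by
    simp [Circle.periodic_exp x]
  have hinv : VAddInvariantMeasure (AddSubgroup.zmultiples (2 * π)) ℝ volume :=
    ⟨fun c s _ => measure_preimage_add _ _ _⟩
  have key : ∀ t, ∫⁻ x in Set.Ioc t (t + 2 * π), g (Circle.exp x) = ∫⁻ z, g z ∂arclength := by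
    intro t
    rw [arclength, lintegral_map hg Circle.exp.continuous.measurable]
    have e : Set.Ioc (-π) π = Set.Ioc (-π) (-π + 2 * π) := by congr 1; ring
    rw [e]
    exact (isAddFundamentalDomain_Ioc hT t).setLIntegral_eq (isAddFundamentalDomain_Ioc hT (-π))
      (fun x => g (Circle.exp x)) hper.map_vadd_zmultiples
  rw [Measure.restrict_congr_set Ioc_ae_eq_Icc.symm, ← Set.Ioc_union_Ioc_eq_Ioc (b := 2 * π) hT.le
    (by linarith), lintegral_union measurableSet_Ioc (Set.Ioc_disjoint_Ioc_of_le le_rfl),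
    two_mul (∫⁻ z, g z ∂arclength)]
  congr 1
  · simpa using key 0
  · rw [← key (2 * π)]
    congr 3
    ring

theorem setLIntegral_energyDensity (δ : ℝ) (f : C(Circle, Circle)) :
    ∫⁻ p in Set.Icc 0 (4 * π) ×ˢ Set.Icc 0 (4 * π),
      energyDensity δ f (Circle.exp p.1, Circle.exp p.2) = 4 * thresholdEnergy δ f := by
  have hm := measurable_energyDensity δ f
  have hexp : Measurable Circle.exp := Circle.exp.continuous.measurable
  have hsf : SFinite arclength := by unfold arclength; infer_instance
  have hm' : Measurable fun p : ℝ × ℝ =>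
      energyDensity δ f (Circle.exp p.1, Circle.exp p.2) :=
    hm.comp (f := fun p : ℝ × ℝ => (Circle.exp p.1, Circle.exp p.2)) (by fun_prop)
  rw [Measure.volume_eq_prod, ← Measure.prod_restrict, lintegral_prod _ hm'.aemeasurable]
  simp only
  have h1 : ∀ x, ∫⁻ y in Set.Icc 0 (4 * π),
      energyDensity δ f (Circle.exp x, Circle.exp y) =
      2 * ∫⁻ z, energyDensity δ f (Circle.exp x, z) ∂arclength := fun x =>
    setLIntegral_comp_exp (g := fun z => energyDensity δ f (Circle.exp x, z))
      (hm.comp measurable_prodMk_left)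
  simp_rw [h1]
  rw [lintegral_const_mul' _ _ (by norm_num),
    setLIntegral_comp_exp (g := fun w => ∫⁻ z, energyDensity δ f (w, z) ∂arclength)
      hm.lintegral_prod_right', ← mul_assoc]
  norm_num
  rfl

/-- The translated angle, lowered by `2 * π * d`, is another lift that agrees at 0; lifts are
unique. -/
theorem HasDegree.exists_lift {f : C(Circle, Circle)} {d : ℤ} (h : HasDegree f d) :
    ∃ φ : C(ℝ, ℝ), (∀ t, f (Circle.exp t) = Circle.exp (φ t)) ∧
      ∀ t, φ (t + 2 * π) = φ t + 2 * π * d := by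
  obtain ⟨φ, hφ, hd⟩ := h
  refine ⟨φ, hφ, ?_⟩
  let ψ : C(ℝ, ℝ) := ⟨fun t => φ (t + 2 * π) - 2 * π * d, by fun_prop⟩
  have h' : ∀ t, Circle.exp (ψ t) = f (Circle.exp t) := fun t => by
    rw [← Circle.periodic_exp t, hφ]
    exact Circle.exp_eq_exp.2 ⟨-d, by simp only [ψ, ContinuousMap.coe_mk]; push_cast; ring⟩
  have h0 : ψ 0 = φ 0 := by
    simp only [ψ, ContinuousMap.coe_mk, zero_add]
    linarith
  have key : ψ = φ :=
    (Circle.isCoveringMap_exp.existsUnique_continuousMap_lifts (f.comp Circle.exp) (0 : ℝ) (φ 0)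
      (hφ 0).symm).unique ⟨h0, funext h'⟩ ⟨rfl, funext fun t => (hφ t).symm⟩
  intro t
  have : ψ t = φ t := by rw [key]
  simp only [ψ, ContinuousMap.coe_mk] at this
  linarith

/-- The constant is 576 · 2 · 4: the bound for one lift, at most two arcs per pair, and the fourfold
covering of the torus by the square of side `4 * π`. -/
theorem mul_natAbs_degree_le (f : C(Circle, Circle)) {δ : ℝ} (hδ : 0 < δ) {N : ℕ}
    (hN : δ ≤ 2 * Real.sin (π / (3 * N))) :
    (N : ℝ≥0∞) * (degree f).natAbs ≤ 4608 * thresholdEnergy δ f := by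
  obtain ⟨φ, hφ, hd⟩ := (degree_eq_iff.1 (rfl : degree f = degree f)).exists_lift
  set d := degree f
  set V : ℕ → ℝ → ℝ := fun j t => collapse N j (φ t / (2 * π)) with hV
  set R : Set (ℝ × ℝ) := Set.Icc 0 (4 * π) ×ˢ Set.Icc 0 (4 * π)
  have hVc : ∀ j < N, Continuous (V j) := fun j hj =>
    (continuous_collapse hj).comp (φ.continuous.div_const _)
  have hVd : ∀ j t, V j (t + 2 * π) = V j t + d := fun j t => by
    simp only [hV]
    rw [hd, ← collapse_add_intCast]
    congr 1
    field_simp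
  have hw : Measurable fun p : ℝ × ℝ => ENNReal.ofReal (1 / (p.1 - p.2) ^ 2) := by fun_prop
  calc (N : ℝ≥0∞) * d.natAbs = ∑ j ∈ range N, (d.natAbs : ℝ≥0∞) := by simp
    _ ≤ ∑ j ∈ range N, 576 * ∫⁻ p in R,
          (farPairs (V j)).indicator (fun p => ENNReal.ofReal (1 / (p.1 - p.2) ^ 2)) p :=
        sum_le_sum fun j hj =>
          natAbs_le_lintegral_farPairs (hVc j (mem_range.1 hj)) (hVd j)
    _ = 576 * ∫⁻ p in R, ∑ j ∈ range N,
          (farPairs (V j)).indicator (fun p => ENNReal.ofReal (1 / (p.1 - p.2) ^ 2)) p := by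
        rw [← mul_sum, lintegral_finsetSum _ fun j hj => ?_]
        exact hw.indicator (measurableSet_farPairs (hVc j (mem_range.1 hj)).measurable)
    _ ≤ 576 * ∫⁻ p in R, 2 * energyDensity δ f (Circle.exp p.1, Circle.exp p.2) := by
        gcongr with p
        obtain ⟨x, y⟩ := p
        set J : ℝ → ℕ := fun t => ⌊N * Int.fract (φ t / (2 * π))⌋₊ with hJ
        set D := energyDensity δ f (Circle.exp x, Circle.exp y) with hD
        calc ∑ j ∈ range N,
              (farPairs (V j)).indicator (fun p => ENNReal.ofReal (1 / (p.1 - p.2) ^ 2)) (x, y)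
            ≤ ∑ j ∈ range N, ((if J x = j then D else 0) + if J y = j then D else 0) := by
              refine sum_le_sum fun j hj => ?_
              by_cases hp : (x, y) ∈ farPairs (V j)
              · obtain ⟨h1, h2⟩ := farPairs_collapse_subset (mem_range.1 hj) φ hp
                have hbad : δ ≤ ‖(f (Circle.exp x) : ℂ) - (f (Circle.exp y) : ℂ)‖ := by
                  rw [hφ, hφ]; exact hN.trans h1
                have hpos : 0 < ‖(Circle.exp x : ℂ) - (Circle.exp y : ℂ)‖ := by
                  rw [norm_pos_iff, sub_ne_zero]
                  intro he
                  rw [Circle.ext he, sub_self, norm_zero] at hbad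
                  linarith
                have hle : ENNReal.ofReal (1 / (x - y) ^ 2) ≤ D := by
                  rw [hD, energyDensity, Set.indicator_of_mem (by exact hbad)]
                  refine ENNReal.ofReal_le_ofReal ?_
                  rw [← sq_abs (x - y)]
                  have := norm_exp_sub_exp_le x y
                  simp only
                  gcongr
                rw [Set.indicator_of_mem hp]
                rcases h2 with h2 | h2
                · rw [if_pos h2]; exact hle.trans le_self_add
                · rw [if_pos h2]; exact hle.trans le_add_self
              · rw [Set.indicator_of_notMem hp]; exact zero_le
          _ ≤ 2 * D := by
              rw [sum_add_distrib, sum_ite_eq, sum_ite_eq, two_mul]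
              gcongr <;> split_ifs <;> simp
    _ = 4608 * thresholdEnergy δ f := by
        rw [lintegral_const_mul' _ _ (by norm_num), setLIntegral_energyDensity, ← mul_assoc,
          ← mul_assoc]
        norm_num

/-- Jordan's inequality gives `2 sin (π / (3 N)) ≥ 4 / (3 N)`, hence `N = ⌊4 / (3 δ)⌋`, which is at
least half of `4 / (3 δ)` when that is at least 1. For larger `δ` take `N = 1`: there `2 sin (π / 3)
= √3` is exactly the allowed range. -/
theorem exists_nat_le_two_mul_sin {δ : ℝ} (hδ : 0 < δ) (hδ' : δ ≤ Real.sqrt 3) :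
    ∃ N : ℕ, δ ≤ 2 * Real.sin (π / (3 * N)) ∧ 1 ≤ 3 / 2 * δ * N := by
  rcases le_or_gt δ (4 / 3) with h | h
  · have hx : 0 ≤ 4 / (3 * δ) := by positivity
    have h1 : 1 ≤ 4 / (3 * δ) := by rw [le_div_iff₀ (by positivity)]; linarith
    have hfl : 1 ≤ ⌊4 / (3 * δ)⌋₊ := Nat.le_floor (by simpa using h1)
    have hN : (1 : ℝ) ≤ ⌊4 / (3 * δ)⌋₊ := by exact_mod_cast hfl
    have hle := Nat.floor_le hx
    have hlt := Nat.lt_floor_add_one (4 / (3 * δ))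
    refine ⟨⌊4 / (3 * δ)⌋₊, ?_, ?_⟩
    · set N : ℝ := (⌊4 / (3 * δ)⌋₊ : ℝ)
      have hpi := Real.pi_pos
      have := Real.mul_le_sin (x := π / (3 * N)) (by positivity) (by
        gcongr; linarith)
      have e : 2 / π * (π / (3 * N)) = 2 / (3 * N) := by field_simp
      rw [e] at this
      rw [le_div_iff₀ (by positivity)] at hle
      have : δ ≤ 2 * (2 / (3 * N)) := by
        rw [← mul_div_assoc, le_div_iff₀ (by positivity)]
        linarith
      linarith
    · set N : ℝ := (⌊4 / (3 * δ)⌋₊ : ℝ)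
      have : 4 / (3 * δ) < 2 * N := by linarith
      rw [div_lt_iff₀ (by positivity)] at this
      linarith
  · refine ⟨1, ?_, ?_⟩
    · rw [Nat.cast_one, mul_one, Real.sin_pi_div_three]
      linarith
    · push_cast; linarith

end CircleDegree

theorem theorem1p4 :
    ∃ c : ℝ≥0, ∀ (f : C(Circle, Circle)) (δ : ℝ), 0 < δ → δ ≤ Real.sqrt 3 →
      ((CircleDegree.degree f).natAbs : ℝ≥0∞) ≤
        (c : ℝ≥0∞) * ENNReal.ofReal δ * CircleDegree.thresholdEnergy δ f := by
  -- Here 6912 = 3/2 · 4608.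
  refine ⟨6912, fun f δ hδ hδ' => ?_⟩
  obtain ⟨N, h1, h2⟩ := CircleDegree.exists_nat_le_two_mul_sin hδ hδ'
  have h3 : (1 : ℝ≥0∞) ≤ ENNReal.ofReal (3 / 2) * ENNReal.ofReal δ * N := by
    rw [← ENNReal.ofReal_natCast, ← ENNReal.ofReal_mul (by norm_num),
      ← ENNReal.ofReal_mul (by positivity), ENNReal.one_le_ofReal]
    exact h2
  have h4 : ENNReal.ofReal (3 / 2) * 4608 = 6912 := by
    rw [← ENNReal.ofReal_ofNat 4608, ← ENNReal.ofReal_mul (by norm_num),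
      ← ENNReal.ofReal_ofNat 6912]
    norm_num
  calc ((CircleDegree.degree f).natAbs : ℝ≥0∞)
      ≤ ENNReal.ofReal (3 / 2) * ENNReal.ofReal δ * N * (CircleDegree.degree f).natAbs :=
        le_mul_of_one_le_left zero_le h3
    _ ≤ ENNReal.ofReal (3 / 2) * ENNReal.ofReal δ *
          (4608 * CircleDegree.thresholdEnergy δ f) := by
        rw [mul_assoc]
        exact mul_le_mul_right (CircleDegree.mul_natAbs_degree_le f hδ h1) _
    _ = _ := by
        rw [← mul_assoc, mul_right_comm (ENNReal.ofReal (3 / 2)), h4]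
        norm_num
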